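/- Let $(A,\mathfrak m)$ be a Cohen–Macaulay (Noetherian) local ring of Krull dimension $d$ and let $I \subsetneq A$ be a proper ideal. Let $m=\mu(I)$ be the minimal number of generators of $I$ and let $g=\operatorname{grade}(I)$ be the maximal length of an $A$-regular sequence contained in $I$; assume $g<m$. Let $u_1,\dots,u_m$ be a minimal system of generators of $I$, and for $i\ge 0$ let $H_i(I)=H_i(u_1,\dots,u_m)$ be the $i$-th homology module of the Koszul complex of $u_1,\dots,u_m$ over $A$ (up to isomorphism it depends only on $I$). Set $$c=\min\{\operatorname{depth} H_i(I) : 0\le i<m-g\},$$ where $\operatorname{depth}$ of a finitely generated $A$-module is the maximal length of a regular sequence on it contained in $\mathfrak m$ (with $\operatorname{depth} 0=\infty$). Then: 1. $\operatorname{depth} H_{m-g}(I)\ge c$. 2. If $c<d-g$, then $\operatorname{depth} H_{m-g}(I)\ge c+1$. -/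

import Mathlib

/-- The grade `grade(I, M)` of an ideal `I` on a module `M`: the supremum of the lengths of the
`M`-regular sequences contained in `I`. A sequence `x₁, …, xₙ` counts as soon as every `xᵢ` is a
nonzerodivisor on `M/(x₁, …, xᵢ₋₁)M`; if `IM ≠ M` the other usual requirement
`(x₁, …, xₙ)M ≠ M` is automatic, and if `IM = M` (with `M` finitely generated over a Noetherian
ring) the value is `⊤`, the usual convention. -/
noncomputable def moduleGrade {A : Type*} [CommRing A] (I : Ideal A)
    (M : Type*) [AddCommGroup M] [Module A M] : ℕ∞ :=
  ⨆ (rs : List A) (_ : (∀ r ∈ rs, r ∈ I) ∧ RingTheory.Sequence.IsWeaklyRegular M rs),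
    (rs.length : ℕ∞)

/-- The depth of a finitely generated module over a Noetherian local ring: the grade of the
maximal ideal on it. The zero module has depth `⊤`. -/
noncomputable def moduleDepth (A : Type*) [CommRing A] [IsLocalRing A]
    (M : Type*) [AddCommGroup M] [Module A M] : ℕ∞ :=
  moduleGrade (IsLocalRing.maximalIdeal A) M

/-- A Cohen–Macaulay local ring: a Noetherian local ring whose depth equals its Krull
dimension. -/
structure IsCohenMacaulayLocal (A : Type*) [CommRing A] [IsLocalRing A] : Prop where
  noetherian : IsNoetherianRing A
  depth_eq_dim : (moduleDepth A A : WithBot ℕ∞) = ringKrullDim A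

/-- The differential of the Koszul complex of `u = (u₁, …, uₘ)` on the whole exterior algebra of
`Aᵐ`: the contraction with the linear form `eⱼ ↦ uⱼ`, so that
`d (x₁ ∧ ⋯ ∧ xₖ) = ∑ⱼ (-1)^(j-1) u(xⱼ) x₁ ∧ ⋯ ∧ x̂ⱼ ∧ ⋯ ∧ xₖ`. -/
noncomputable def koszulDifferential {A : Type*} [CommRing A] {m : ℕ} (u : Fin m → A) :
    ExteriorAlgebra A (Fin m → A) →ₗ[A] ExteriorAlgebra A (Fin m → A) :=
  CliffordAlgebra.contractLeft (Q := (0 : QuadraticForm A (Fin m → A)))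
    (Fintype.linearCombination A u)

/-- The Koszul differential lowers the degree by one. -/
theorem koszulDifferential_mem {A : Type*} [CommRing A] {m : ℕ} (u : Fin m → A) (i : ℕ)
    (x : ExteriorAlgebra A (Fin m → A)) (hx : x ∈ ⋀[A]^(i + 1) (Fin m → A)) :
    koszulDifferential u x ∈ ⋀[A]^i (Fin m → A) := by
  induction i generalizing x with
  | zero =>
    rw [zero_add, ExteriorAlgebra.exteriorPower, pow_one] at hx
    obtain ⟨v, rfl⟩ := hx
    rw [koszulDifferential, ExteriorAlgebra.ι, CliffordAlgebra.contractLeft_ι,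
      ExteriorAlgebra.exteriorPower,
      pow_zero, Submodule.mem_one]
    exact ⟨_, rfl⟩
  | succ i ih =>
    rw [ExteriorAlgebra.exteriorPower, pow_succ'] at hx
    induction hx using Submodule.mul_induction_on' with
    | mem_mul_mem a ha y hy =>
      obtain ⟨v, rfl⟩ := ha
      rw [koszulDifferential, ExteriorAlgebra.ι, CliffordAlgebra.contractLeft_ι_mul]
      refine Submodule.sub_mem _ (Submodule.smul_mem _ _ hy) ?_
      rw [ExteriorAlgebra.exteriorPower, pow_succ']
      exact Submodule.mul_mem_mul ⟨v, rfl⟩ (ih y hy)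
    | add a _ b _ iha ihb =>
      rw [map_add]
      exact Submodule.add_mem _ iha ihb

/-- The Koszul differential squares to zero. -/
theorem koszulDifferential_comp_self {A : Type*} [CommRing A] {m : ℕ} (u : Fin m → A) :
    koszulDifferential u ∘ₗ koszulDifferential u = 0 :=
  LinearMap.ext fun x => CliffordAlgebra.contractLeft_contractLeft _ x

/-- The Koszul cycles of degree `i`: the kernel of `d` on `Kᵢ(u) = ⋀ⁱ(Aᵐ)`. -/
noncomputable def koszulCycles {A : Type*} [CommRing A] {m : ℕ} (u : Fin m → A) (i : ℕ) :
    Submodule A (ExteriorAlgebra A (Fin m → A)) :=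
  (⋀[A]^i (Fin m → A)) ⊓ LinearMap.ker (koszulDifferential u)

/-- The Koszul boundaries of degree `i`: the image of `Kᵢ₊₁(u) = ⋀ⁱ⁺¹(Aᵐ)` under `d`. -/
noncomputable def koszulBoundaries {A : Type*} [CommRing A] {m : ℕ} (u : Fin m → A) (i : ℕ) :
    Submodule A (ExteriorAlgebra A (Fin m → A)) :=
  (⋀[A]^(i + 1) (Fin m → A)).map (koszulDifferential u)

/-- Boundaries are cycles. -/
theorem koszulBoundaries_le_koszulCycles {A : Type*} [CommRing A] {m : ℕ} (u : Fin m → A)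
    (i : ℕ) : koszulBoundaries u i ≤ koszulCycles u i := by
  rintro _ ⟨x, hx, rfl⟩
  exact ⟨koszulDifferential_mem u i x hx, LinearMap.congr_fun (koszulDifferential_comp_self u) x⟩

/-- The Koszul homology module `Hᵢ(u)`: cycles modulo boundaries. -/
abbrev KoszulHomology {A : Type*} [CommRing A] {m : ℕ} (u : Fin m → A) (i : ℕ) : Type _ :=
  koszulCycles u i ⧸ (koszulBoundaries u i).submoduleOf (koszulCycles u i)

universe v

open CategoryTheory Abelian RingTheory.Sequence

/-! ### Grade through weakly regular sequences -/

section Grade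

variable {A : Type*} [CommRing A]

/-! Write Z_i and B_i for the cycles and boundaries of the Koszul complex K. The bound behind both
claims is depth H_{m-g} ≥ min(d - g, c + 2). It comes from chasing depth through 0 → B_i → Z_i → H_i
→ 0 and 0 → Z_{i+1} → K_{i+1} → B_i → 0.

Above degree m - g the complex is exact (`koszulBoundaries_eq_koszulCycles`), so the tail of K is a
free resolution of B_{m-g}; as depth A = d, this gives depth B_{m-g} ≥ d - g + 1. From below,
starting at Z_0 = K_0, the depths of the lower H_i give depth Z_{m-g} ≥ min(d, c + 2)
(`natCast_le_moduleDepth_koszulCycles`).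

Finally H_0 = A/I is nonzero and killed by I, so c ≤ d - g, and both claims can be read off the
minimum. -/

theorem natCast_le_moduleGrade_iff {I : Ideal A} {M : Type*} [AddCommGroup M] [Module A M]
    {n : ℕ} : (n : ℕ∞) ≤ moduleGrade I M ↔
      ∃ rs : List A, rs.length = n ∧ (∀ r ∈ rs, r ∈ I) ∧ IsWeaklyRegular M rs := by
  constructor
  · intro h
    rcases n with _ | n
    · exact ⟨[], by simp⟩
    · have h' : (n : ℕ∞) < moduleGrade I M :=
        lt_of_lt_of_le (by exact_mod_cast n.lt_succ_self) h
      simp only [moduleGrade, lt_iSup_iff] at h'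
      obtain ⟨rs, ⟨hI, hr⟩, hn⟩ := h'
      have hn : n < rs.length := by exact_mod_cast hn
      refine ⟨rs.take (n + 1), by simpa using hn, fun r hr => hI r (List.mem_of_mem_take hr), ?_⟩
      rw [← List.take_append_drop (n + 1) rs, isWeaklyRegular_append_iff] at hr
      exact hr.1
  · rintro ⟨rs, rfl, hI, hr⟩
    exact le_iSup₂_of_le (f := fun (rs : List A) (_ : (∀ r ∈ rs, r ∈ I) ∧
      IsWeaklyRegular M rs) => (rs.length : ℕ∞)) rs ⟨hI, hr⟩ le_rfl

theorem LinearEquiv.moduleGrade_eq {I : Ideal A} {M N : Type*} [AddCommGroup M] [Module A M]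
    [AddCommGroup N] [Module A N] (e : M ≃ₗ[A] N) : moduleGrade I M = moduleGrade I N := by
  simp only [moduleGrade, e.isWeaklyRegular_congr]

theorem moduleGrade_le_of_flat (I : Ideal A) (F : Type*) [AddCommGroup F] [Module A F]
    [Module.Flat A F] : moduleGrade I A ≤ moduleGrade I F := by
  refine iSup₂_le fun rs h => ?_
  exact natCast_le_moduleGrade_iff.mpr ⟨rs, rfl, h.1,
    ((TensorProduct.rid A F).isWeaklyRegular_congr rs).mp h.2.isWeaklyRegular_lTensor⟩

theorem moduleGrade_of_subsingleton (I : Ideal A) (M : Type*) [AddCommGroup M] [Module A M]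
    [Subsingleton M] : moduleGrade I M = ⊤ := by
  refine ENat.eq_top_iff_forall_ge.mpr fun n =>
    natCast_le_moduleGrade_iff.mpr ⟨List.replicate n 0, by simp, ?_, ⟨fun i hi => ?_⟩⟩
  · intro r hr
    rw [List.eq_of_mem_replicate hr]
    exact I.zero_mem
  · exact fun x y _ => Subsingleton.elim x y

end Grade

/-! ### Short exact sequences of modules -/

section ShortExact

variable {A : Type v} [CommRing A] {L M N : Type v} [AddCommGroup L] [Module A L]
  [AddCommGroup M] [Module A M] [AddCommGroup N] [Module A N]
  {f : L →ₗ[A] M} {g : M →ₗ[A] N}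

theorem shortExact_moduleCat_of_exact (hf : Function.Injective f) (hfg : Function.Exact f g)
    (hg : Function.Surjective g) :
    (ShortComplex.mk (ModuleCat.ofHom f) (ModuleCat.ofHom g)
      (by ext x; exact hfg.apply_apply_eq_zero x)).ShortExact where
  exact := (ShortComplex.ShortExact.moduleCat_exact_iff_function_exact _).mpr hfg
  mono_f := (ModuleCat.mono_iff_injective _).mpr hf
  epi_g := (ModuleCat.epi_iff_surjective _).mpr hg

end ShortExact

/-! ### Depth through Ext -/

section Depth

variable {A : Type v} [CommRing A] [IsLocalRing A] [IsNoetherianRing A]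

/-- Rees' criterion, which makes depth accessible to long exact sequences. It needs 𝔪M ≠ M, so the
zero module is treated apart. -/
theorem natCast_le_moduleDepth_iff {M : Type v} [AddCommGroup M] [Module A M] [Module.Finite A M]
    {n : ℕ} : (n : ℕ∞) ≤ moduleDepth A M ↔
      ∀ i < n, Subsingleton (Ext (ModuleCat.of A (Shrink.{v} (A ⧸ IsLocalRing.maximalIdeal A)))
        (ModuleCat.of A M) i) := by
  rcases subsingleton_or_nontrivial M with hM | hM
  · simp only [moduleDepth, moduleGrade_of_subsingleton, le_top, true_iff]
    intro i _
    have h0 : 𝟙 (ModuleCat.of A M) = 0 := by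
      ext x
      exact Subsingleton.elim (α := M) _ _
    refine subsingleton_of_forall_eq 0 fun x => ?_
    rw [← Ext.comp_mk₀_id x, h0, Ext.mk₀_zero, Ext.comp_zero]
  · have hlt : IsLocalRing.maximalIdeal A • (⊤ : Submodule A M) < ⊤ :=
      lt_top_iff_ne_top.mpr (Submodule.top_ne_ideal_smul_of_le_jacobson_annihilator
        (IsLocalRing.maximalIdeal_le_jacobson _)).symm
    rw [moduleDepth, natCast_le_moduleGrade_iff]
    refine Iff.trans ?_ ((ModuleCat.exists_isRegular_tfae (IsLocalRing.maximalIdeal A) n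
      (ModuleCat.of A M) hlt).out 3 1)
    refine exists_congr fun rs => and_congr_right fun _ => and_congr_right fun h => ?_
    exact (IsLocalRing.isRegular_iff_isWeaklyRegular_of_subset_maximalIdeal h).symm

variable {L M N : Type v} [AddCommGroup L] [Module A L] [Module.Finite A L]
  [AddCommGroup M] [Module A M] [Module.Finite A M]
  [AddCommGroup N] [Module A N] [Module.Finite A N]
  {f : L →ₗ[A] M} {g : M →ₗ[A] N}

/-- In a short exact sequence `0 → L → M → N → 0`, `depth L ≥ min (depth M) (depth N + 1)`. -/
theorem natCast_le_moduleDepth_left (hf : Function.Injective f) (hfg : Function.Exact f g)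
    (hg : Function.Surjective g) {n : ℕ} (hM : (n : ℕ∞) ≤ moduleDepth A M)
    (hN : ((n - 1 : ℕ) : ℕ∞) ≤ moduleDepth A N) : (n : ℕ∞) ≤ moduleDepth A L := by
  have hS := shortExact_moduleCat_of_exact hf hfg hg
  rw [natCast_le_moduleDepth_iff] at *
  intro i hi
  refine subsingleton_of_forall_eq 0 fun x => ?_
  have h2 := hM i hi
  rcases i with _ | i
  · exact Ext.postcomp_mk₀_injective_of_mono _ (ModuleCat.ofHom f)
      (hf := hS.mono_f) (Subsingleton.elim _ _)
  · obtain ⟨y, rfl⟩ := Ext.covariant_sequence_exact₁ _ hS x (Subsingleton.elim _ _) rfl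
    have h3 := hN i (by omega)
    rw [Subsingleton.elim y 0, Ext.zero_comp]

/-- In a short exact sequence `0 → L → M → N → 0`, `depth N ≥ min (depth L - 1) (depth M)`. -/
theorem natCast_le_moduleDepth_right (hf : Function.Injective f) (hfg : Function.Exact f g)
    (hg : Function.Surjective g) {n : ℕ} (hL : ((n + 1 : ℕ) : ℕ∞) ≤ moduleDepth A L)
    (hM : (n : ℕ∞) ≤ moduleDepth A M) : (n : ℕ∞) ≤ moduleDepth A N := by
  have hS := shortExact_moduleCat_of_exact hf hfg hg
  rw [natCast_le_moduleDepth_iff] at *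
  intro i hi
  refine subsingleton_of_forall_eq 0 fun x => ?_
  have h1 := hL (i + 1) (by omega)
  have h2 := hM i hi
  obtain ⟨y, rfl⟩ := Ext.covariant_sequence_exact₃ _ hS x rfl (Subsingleton.elim _ _)
  rw [Subsingleton.elim y 0, Ext.zero_comp]

/-- The depth of a nonzero module annihilated by `I` is at most `dim A - grade I`. -/
theorem add_le_ringKrullDim_of_le_moduleDepth [Nontrivial M] {I : Ideal A} (hI : I ≠ ⊤)
    (hIM : I ≤ Module.annihilator A M) {n g : ℕ} (hn : (n : ℕ∞) ≤ moduleDepth A M)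
    (hg : (g : ℕ∞) ≤ moduleGrade I A) : ((n + g : ℕ) : WithBot ℕ∞) ≤ ringKrullDim A := by
  obtain ⟨rs, rfl, hrs, hreg⟩ := natCast_le_moduleGrade_iff.mp hn
  obtain ⟨as, rfl, has, hareg⟩ := natCast_le_moduleGrade_iff.mp hg
  have hreg' := (IsLocalRing.isRegular_iff_isWeaklyRegular_of_subset_maximalIdeal hrs).mpr hreg
  have hareg' := (IsLocalRing.isRegular_iff_isWeaklyRegular_of_subset_maximalIdeal
    fun r hr => IsLocalRing.le_maximalIdeal hI (has r hr)).mpr hareg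
  have h1 := Module.supportDim_add_length_eq_supportDim_of_isRegular rs hreg'
  have h2 := ringKrullDim_add_length_eq_ringKrullDim_of_isRegular as hareg'
  have hnt := hreg'.quot_ofList_smul_nontrivial ⊤
  have h3 : 0 ≤ Module.supportDim A (M ⧸ Ideal.ofList rs • (⊤ : Submodule A M)) := by
    rw [← not_lt]
    intro h
    exact Module.supportDim_ne_bot_of_nontrivial A _ (WithBot.lt_coe_bot.mp h)
  -- Since (as) ⊆ I ⊆ Ann M, the support of M lies in V(as), of dimension dim A - g.
  have h4 : Module.supportDim A M ≤ ringKrullDim (A ⧸ Ideal.ofList as) := by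
    rw [Module.supportDim_eq_ringKrullDim_quotient_annihilator]
    exact ringKrullDim_le_of_surjective (Ideal.Quotient.factor
      ((Ideal.span_le.mpr has).trans hIM)) (Ideal.Quotient.factor_surjective _)
  rw [← h2]
  push_cast
  gcongr
  calc (rs.length : WithBot ℕ∞) = 0 + rs.length := (zero_add _).symm
    _ ≤ _ := by gcongr
    _ ≤ _ := h1.le.trans h4

end Depth

/-! ### Regular elements modulo an ideal -/

section RegularModulo

open scoped TensorProduct Pointwise

variable {A : Type*} [CommRing A]

/-- Tensoring with the flat module F keeps multiplication by a on A/J injective, and F ⊗ A/J = F/JF.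
-/
theorem mem_smul_of_smul_mem_of_flat {J : Ideal A} {a : A} (ha : IsSMulRegular (A ⧸ J) a)
    {E : Type*} [AddCommGroup E] [Module A E] (F : Submodule A E) [Module.Flat A F] {x : E}
    (hx : x ∈ F) (hax : a • x ∈ J • F) : x ∈ J • F := by
  have hF : J • F = (J • (⊤ : Submodule A F)).map F.subtype := by
    rw [Submodule.map_smul'', Submodule.map_subtype_top]
  have hreg : IsSMulRegular (F ⧸ (J • ⊤ : Submodule A F)) a :=
    ((TensorProduct.tensorQuotEquivQuotSMul F J).isSMulRegular_congr a).mp (ha.lTensor F)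
  rw [hF] at hax ⊢
  obtain ⟨y, hy, hyx⟩ := hax
  have hy' : y = a • ⟨x, hx⟩ := Subtype.ext hyx
  refine ⟨⟨x, hx⟩, ?_, rfl⟩
  rw [SetLike.mem_coe, ← Submodule.Quotient.mk_eq_zero]
  refine hreg ?_
  change a • _ = a • _
  rw [smul_zero]
  rwa [hy', SetLike.mem_coe, ← Submodule.Quotient.mk_eq_zero] at hy

/-- `(A/J)/a(A/J) ≃ A/(J + (a))`. -/
noncomputable def quotSMulTopQuotientEquiv (J : Ideal A) (a : A) :
    QuotSMulTop a (A ⧸ J) ≃ₗ[A] A ⧸ (J ⊔ Ideal.span {a}) :=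
  (Submodule.quotEquivOfEq _ _ (by
    rw [← Submodule.ideal_span_singleton_smul, ← Submodule.range_mkQ J, ← Submodule.map_top,
      ← Submodule.map_smul'', smul_eq_mul, Ideal.mul_top])).trans
    (Submodule.quotientQuotientEquivQuotientSup J (Ideal.span {a}))

end RegularModulo

/-! ### Koszul complex: grade sensitivity and annihilation -/

section Koszul

open scoped Pointwise

variable {A : Type*} [CommRing A] {m : ℕ} (u : Fin m → A)

theorem koszulDifferential_ι (v : Fin m → A) :
    koszulDifferential u (ExteriorAlgebra.ι A v) =
      algebraMap A _ (Fintype.linearCombination A u v) := by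
  rw [koszulDifferential, ExteriorAlgebra.ι, CliffordAlgebra.contractLeft_ι]

theorem koszulDifferential_ι_mul (v : Fin m → A) (x : ExteriorAlgebra A (Fin m → A)) :
    koszulDifferential u (ExteriorAlgebra.ι A v * x) =
      Fintype.linearCombination A u v • x - ExteriorAlgebra.ι A v * koszulDifferential u x := by
  rw [koszulDifferential, ExteriorAlgebra.ι, CliffordAlgebra.contractLeft_ι_mul]

theorem koszulDifferential_koszulDifferential (x : ExteriorAlgebra A (Fin m → A)) :
    koszulDifferential u (koszulDifferential u x) = 0 :=
  LinearMap.congr_fun (koszulDifferential_comp_self u) x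

variable {u} in
theorem exists_linearCombination_eq {a : A} (ha : a ∈ Ideal.span (Set.range u)) :
    ∃ v : Fin m → A, Fintype.linearCombination A u v = a := by
  rwa [Ideal.span, ← Fintype.range_linearCombination] at ha

theorem ι_mul_mem_exteriorPower {i : ℕ} (v : Fin m → A) {x : ExteriorAlgebra A (Fin m → A)}
    (hx : x ∈ ⋀[A]^i (Fin m → A)) : ExteriorAlgebra.ι A v * x ∈ ⋀[A]^(i + 1) (Fin m → A) := by
  rw [ExteriorAlgebra.exteriorPower, pow_succ']
  exact Submodule.mul_mem_mul ⟨v, rfl⟩ hx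

theorem exteriorPower_eq_bot {i : ℕ} (hi : m < i) : ⋀[A]^i (Fin m → A) = ⊥ := by
  have hE : IsEmpty (Set.powersetCard (Fin m) i) := by
    refine ⟨fun s => ?_⟩
    have h1 : (s : Finset (Fin m)).card = i := s.2
    have h2 := Finset.card_le_univ (s : Finset (Fin m))
    rw [Fintype.card_fin] at h2
    omega
  have := ((Pi.basisFun A (Fin m)).exteriorPower i).repr.toEquiv.subsingleton
  exact Submodule.subsingleton_iff_eq_bot.mp this

theorem smul_exteriorPower_le_comap_koszulDifferential (J : Ideal A) (i : ℕ) :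
    J • ⋀[A]^(i + 1) (Fin m → A) ≤ (J • ⋀[A]^i (Fin m → A)).comap (koszulDifferential u) := by
  rw [← Submodule.map_le_iff_le_comap, Submodule.map_smul'']
  refine Submodule.smul_mono le_rfl ?_
  rintro _ ⟨x, hx, rfl⟩
  exact koszulDifferential_mem u i x hx

theorem ι_mul_mem_smul_exteriorPower {J : Ideal A} {i : ℕ} (v : Fin m → A)
    {x : ExteriorAlgebra A (Fin m → A)} (hx : x ∈ J • ⋀[A]^i (Fin m → A)) :
    ExteriorAlgebra.ι A v * x ∈ J • ⋀[A]^(i + 1) (Fin m → A) := by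
  have h : J • ⋀[A]^i (Fin m → A) ≤ (J • ⋀[A]^(i + 1) (Fin m → A)).comap
      (LinearMap.mulLeft A (ExteriorAlgebra.ι A v)) := by
    rw [← Submodule.map_le_iff_le_comap, Submodule.map_smul'']
    refine Submodule.smul_mono le_rfl ?_
    rintro _ ⟨x, hx, rfl⟩
    exact ι_mul_mem_exteriorPower v hx
  exact h hx

/-- Grade sensitivity of the Koszul complex over `A/J`, phrased with representatives in `A`. -/
theorem exists_sub_koszulDifferential_mem_smul (rs : List A) (J : Ideal A) (i : ℕ)
    (hrs : ∀ r ∈ rs, r ∈ Ideal.span (Set.range u)) (hreg : IsWeaklyRegular (A ⧸ J) rs)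
    (hi : m < i + 1 + rs.length) (x : ExteriorAlgebra A (Fin m → A))
    (hx : x ∈ ⋀[A]^(i + 1) (Fin m → A)) (hdx : koszulDifferential u x ∈ J • ⋀[A]^i (Fin m → A)) :
    ∃ w ∈ ⋀[A]^(i + 1 + 1) (Fin m → A),
      x - koszulDifferential u w ∈ J • ⋀[A]^(i + 1) (Fin m → A) := by
  induction rs generalizing J i x with
  | nil =>
    rw [exteriorPower_eq_bot (by simpa using hi), Submodule.mem_bot] at hx
    exact ⟨0, Submodule.zero_mem _, by simp [hx]⟩
  | cons a rs ih =>
    rw [isWeaklyRegular_cons_iff] at hreg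
    obtain ⟨ha, hreg⟩ := hreg
    rw [(quotSMulTopQuotientEquiv J a).isWeaklyRegular_congr] at hreg
    -- With u(v) = a, the element v ∧ x is a cycle modulo J + (a), one degree higher; this offsets
    -- the shorter sequence.
    obtain ⟨v, hv⟩ := exists_linearCombination_eq (hrs a List.mem_cons_self)
    have hdy := koszulDifferential_ι_mul u v x
    rw [hv] at hdy
    have hdx' := ι_mul_mem_smul_exteriorPower v hdx
    have hsup (k : ℕ) : (J ⊔ Ideal.span {a}) • ⋀[A]^k (Fin m → A) =
        J • ⋀[A]^k (Fin m → A) ⊔ Ideal.span {a} • ⋀[A]^k (Fin m → A) := Submodule.sup_smul ..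
    obtain ⟨z, hz, hyz⟩ := ih (J ⊔ Ideal.span {a}) (i + 1)
      (fun r hr => hrs r (List.mem_cons_of_mem _ hr)) hreg
      (by rw [List.length_cons] at hi; omega) (ExteriorAlgebra.ι A v * x)
      (ι_mul_mem_exteriorPower v hx) (by
        rw [hdy, hsup, sub_eq_neg_add]
        exact Submodule.add_mem_sup (Submodule.neg_mem _ hdx')
          (Submodule.smul_mem_smul (Ideal.mem_span_singleton_self a) hx))
    rw [hsup] at hyz
    obtain ⟨p, hp, q, hq, hpq⟩ := Submodule.mem_sup.mp hyz
    rw [Submodule.ideal_span_singleton_smul] at hq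
    obtain ⟨w, hw, rfl⟩ := (Submodule.mem_smul_pointwise_iff_exists _ _ _).mp hq
    -- Applying d to v ∧ x - dz = p + a w removes z and leaves a (x - dw) = v ∧ dx + dp, which lies
    -- in J K; then a cancels modulo J.
    refine ⟨w, hw, mem_smul_of_smul_mem_of_flat ha _
      (Submodule.sub_mem _ hx (koszulDifferential_mem u _ w hw)) ?_⟩
    have hd := congrArg (koszulDifferential u) hpq
    rw [map_add, map_smul, map_sub, hdy, koszulDifferential_koszulDifferential, sub_zero] at hd
    rw [smul_sub, show a • x - a • koszulDifferential u w =
      ExteriorAlgebra.ι A v * koszulDifferential u x + koszulDifferential u p by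
        rw [sub_eq_iff_eq_add, add_assoc, hd]; abel]
    exact Submodule.add_mem _ hdx' (smul_exteriorPower_le_comap_koszulDifferential u J _ hp)

theorem koszulBoundaries_eq_koszulCycles {g i : ℕ}
    (hg : (g : ℕ∞) ≤ moduleGrade (Ideal.span (Set.range u)) A) (hi : m < i + 1 + g) :
    koszulBoundaries u (i + 1) = koszulCycles u (i + 1) := by
  refine le_antisymm (koszulBoundaries_le_koszulCycles u _) fun x hx => ?_
  obtain ⟨rs, rfl, hrs, hreg⟩ := natCast_le_moduleGrade_iff.mp hg
  obtain ⟨w, hw, h⟩ := exists_sub_koszulDifferential_mem_smul u rs ⊥ i hrs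
    (((Submodule.quotEquivOfEqBot (⊥ : Ideal A) rfl).isWeaklyRegular_congr rs).mpr hreg) hi x
    hx.1 (by rw [LinearMap.mem_ker.mp hx.2]; exact Submodule.zero_mem _)
  rw [Submodule.bot_smul, Submodule.mem_bot, sub_eq_zero] at h
  exact ⟨w, hw, h.symm⟩

/-- If u(v) = a, then left multiplication by v is a homotopy from a to 0. -/
theorem span_le_annihilator_koszulHomology (i : ℕ) :
    Ideal.span (Set.range u) ≤ Module.annihilator A (KoszulHomology u i) := by
  intro a ha
  obtain ⟨v, rfl⟩ := exists_linearCombination_eq ha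
  rw [Module.mem_annihilator]
  intro y
  obtain ⟨⟨x, hx⟩, rfl⟩ := Submodule.mkQ_surjective _ y
  rw [← map_smul, Submodule.mkQ_apply, Submodule.Quotient.mk_eq_zero]
  refine ⟨ExteriorAlgebra.ι A v * x, ι_mul_mem_exteriorPower v hx.1, ?_⟩
  rw [koszulDifferential_ι_mul, LinearMap.mem_ker.mp hx.2, mul_zero, sub_zero]
  rfl

theorem koszulCycles_zero : koszulCycles u 0 = ⋀[A]^0 (Fin m → A) := by
  refine inf_eq_left.mpr fun x hx => ?_
  rw [ExteriorAlgebra.exteriorPower, pow_zero, Submodule.mem_one] at hx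
  obtain ⟨a, rfl⟩ := hx
  rw [LinearMap.mem_ker, koszulDifferential]
  exact CliffordAlgebra.contractLeft_algebraMap (Q := (0 : QuadraticForm A (Fin m → A))) _ _

theorem nontrivial_koszulHomology_zero (hu : Ideal.span (Set.range u) ≠ ⊤) :
    Nontrivial (KoszulHomology u 0) := by
  have h1 : (1 : ExteriorAlgebra A (Fin m → A)) ∈ koszulCycles u 0 := by
    rw [koszulCycles_zero, ExteriorAlgebra.exteriorPower, pow_zero]
    exact Submodule.one_le.mp le_rfl
  refine ⟨Submodule.Quotient.mk ⟨1, h1⟩, 0, fun h => hu ?_⟩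
  rw [Submodule.Quotient.mk_eq_zero] at h
  obtain ⟨x, hx, hx1⟩ := h
  rw [ExteriorAlgebra.exteriorPower, zero_add, pow_one] at hx
  obtain ⟨v, rfl⟩ := hx
  rw [koszulDifferential_ι] at hx1
  have hv : Fintype.linearCombination A u v = 1 :=
    ExteriorAlgebra.algebraMap_leftInverse (Fin m → A) |>.injective (hx1.trans (map_one _).symm)
  rw [Ideal.eq_top_iff_one, ← hv, Ideal.span, ← Fintype.range_linearCombination]
  exact ⟨v, rfl⟩

end Koszul

/-! ### Exact sequences of cycles and boundaries -/

section KoszulExact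

variable {A : Type*} [CommRing A] {m : ℕ} (u : Fin m → A)

theorem koszulCycles_le (i : ℕ) : koszulCycles u i ≤ ⋀[A]^i (Fin m → A) :=
  inf_le_left

/-- The differential as a surjection `⋀ⁱ⁺¹ → Bᵢ`. -/
noncomputable def toKoszulBoundaries (i : ℕ) :
    ⋀[A]^(i + 1) (Fin m → A) →ₗ[A] koszulBoundaries u i :=
  (koszulDifferential u).submoduleMap _

theorem exact_toKoszulBoundaries (i : ℕ) :
    Function.Exact (Submodule.inclusion (koszulCycles_le u (i + 1)))
      (toKoszulBoundaries u i) := by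
  intro x
  rw [← LinearMap.coe_range, Submodule.range_inclusion]
  refine Subtype.ext_iff.trans ⟨fun h => ⟨x.2, h⟩, fun h => h.2⟩

variable [IsLocalRing A]

theorem le_moduleDepth_exteriorPower (i : ℕ) :
    moduleDepth A A ≤ moduleDepth A (⋀[A]^i (Fin m → A)) :=
  moduleGrade_le_of_flat _ _

theorem moduleDepth_submoduleOf (i : ℕ) :
    moduleDepth A ((koszulBoundaries u i).submoduleOf (koszulCycles u i)) =
      moduleDepth A (koszulBoundaries u i) :=
  (Submodule.submoduleOfEquivOfLe (koszulBoundaries_le_koszulCycles u i)).moduleGrade_eq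

end KoszulExact

/-! ### Depth of cycles, boundaries and homology -/

section KoszulDepth

variable {A : Type*} [CommRing A] [IsLocalRing A] [IsNoetherianRing A] {m : ℕ} (u : Fin m → A)

instance finite_koszulCycles (i : ℕ) : Module.Finite A (koszulCycles u i) :=
  Module.Finite.of_injective (Submodule.inclusion (koszulCycles_le u i))
    (Submodule.inclusion_injective _)

instance finite_koszulBoundaries (i : ℕ) : Module.Finite A (koszulBoundaries u i) :=
  inferInstanceAs (Module.Finite A ((⋀[A]^(i + 1) (Fin m → A)).map (koszulDifferential u)))

theorem natCast_le_moduleDepth_koszulCycles_succ {n i : ℕ} (hA : (n : ℕ∞) ≤ moduleDepth A A)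
    (hB : ((n - 1 : ℕ) : ℕ∞) ≤ moduleDepth A (koszulBoundaries u i)) :
    (n : ℕ∞) ≤ moduleDepth A (koszulCycles u (i + 1)) :=
  natCast_le_moduleDepth_left (Submodule.inclusion_injective _) (exact_toKoszulBoundaries u i)
    (LinearMap.submoduleMap_surjective _ _) (hA.trans (le_moduleDepth_exteriorPower _)) hB

theorem natCast_le_moduleDepth_koszulBoundaries_of_koszulCycles_succ {n i : ℕ}
    (hA : (n : ℕ∞) ≤ moduleDepth A A)
    (hZ : ((n + 1 : ℕ) : ℕ∞) ≤ moduleDepth A (koszulCycles u (i + 1))) :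
    (n : ℕ∞) ≤ moduleDepth A (koszulBoundaries u i) :=
  natCast_le_moduleDepth_right (Submodule.inclusion_injective _) (exact_toKoszulBoundaries u i)
    (LinearMap.submoduleMap_surjective _ _) hZ (hA.trans (le_moduleDepth_exteriorPower _))

theorem natCast_le_moduleDepth_koszulBoundaries {n i : ℕ}
    (hZ : (n : ℕ∞) ≤ moduleDepth A (koszulCycles u i))
    (hH : ((n - 1 : ℕ) : ℕ∞) ≤ moduleDepth A (KoszulHomology u i)) :
    (n : ℕ∞) ≤ moduleDepth A (koszulBoundaries u i) :=
  (natCast_le_moduleDepth_left (Submodule.subtype_injective _) (LinearMap.exact_subtype_mkQ _)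
    (Submodule.mkQ_surjective _) hZ hH).trans_eq (moduleDepth_submoduleOf u i)

theorem natCast_le_moduleDepth_koszulHomology {n i : ℕ}
    (hB : ((n + 1 : ℕ) : ℕ∞) ≤ moduleDepth A (koszulBoundaries u i))
    (hZ : (n : ℕ∞) ≤ moduleDepth A (koszulCycles u i)) :
    (n : ℕ∞) ≤ moduleDepth A (KoszulHomology u i) :=
  natCast_le_moduleDepth_right (Submodule.subtype_injective _) (LinearMap.exact_subtype_mkQ _)
    (Submodule.mkQ_surjective _) (hB.trans_eq (moduleDepth_submoduleOf u i).symm) hZ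

/-- The boundaries in degree `i ≥ m - g` are resolved by the tail of the Koszul complex. -/
theorem natCast_le_moduleDepth_koszulBoundaries_of_le_grade {g d : ℕ}
    (hg : (g : ℕ∞) ≤ moduleGrade (Ideal.span (Set.range u)) A) (hd : (d : ℕ∞) ≤ moduleDepth A A)
    {j i : ℕ} (hj : j ≤ g) (hi : m ≤ i + j) (hjd : j ≤ d) :
    ((d + 1 - j : ℕ) : ℕ∞) ≤ moduleDepth A (koszulBoundaries u i) := by
  induction j generalizing i with
  | zero =>
    have : Subsingleton (koszulBoundaries u i) := by
      rw [Submodule.subsingleton_iff_eq_bot, koszulBoundaries,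
        exteriorPower_eq_bot (by omega), Submodule.map_bot]
    rw [moduleDepth, moduleGrade_of_subsingleton]
    exact le_top
  | succ j ih =>
    refine natCast_le_moduleDepth_koszulBoundaries_of_koszulCycles_succ u ?_ ?_
    · exact le_trans (by exact_mod_cast (by omega)) hd
    -- Exactness in degree i + 1 gives Z_{i+1} = B_{i+1}; each step down the tail costs one unit of
    -- depth.
    · rw [← koszulBoundaries_eq_koszulCycles u hg (by omega)]
      convert ih (i := i + 1) (by omega) (by omega) (by omega) using 2
      omega

/-- Cycles and boundaries below the last nonzero Koszul homology. -/
theorem natCast_le_moduleDepth_koszulCycles {s n : ℕ} (hA : (n : ℕ∞) ≤ moduleDepth A A)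
    (hH : ∀ i < s, ((n - 1 - 1 : ℕ) : ℕ∞) ≤ moduleDepth A (KoszulHomology u i)) :
    (n : ℕ∞) ≤ moduleDepth A (koszulCycles u s) := by
  induction s with
  | zero =>
    rw [koszulCycles_zero]
    exact hA.trans (le_moduleDepth_exteriorPower _)
  | succ s ih =>
    have hZ := ih fun i hi => hH i (by omega)
    -- Depth n for Z_{s+1} asks only n - 1 of B_s, hence only n - 2 of H_s: this is the gain of two.
    refine natCast_le_moduleDepth_koszulCycles_succ u hA
      (natCast_le_moduleDepth_koszulBoundaries u (le_trans ?_ hZ) (hH s s.lt_succ_self))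
    exact_mod_cast n.sub_le 1

end KoszulDepth

theorem theorem1p8 {A : Type*} [CommRing A] [IsLocalRing A] (hA : IsCohenMacaulayLocal A)
    (d : ℕ) (hd : ringKrullDim A = d)
    (I : Ideal A) (hI : I ≠ ⊤)
    (m : ℕ) (hm : m = I.spanFinrank)
    (g : ℕ) (hg : (g : ℕ∞) = moduleGrade I A)
    (hgm : g < m)
    (u : Fin m → A) (hu : Ideal.span (Set.range u) = I)
    (c : ℕ∞) (hc : c = ⨅ i : Fin (m - g), moduleDepth A (KoszulHomology u i)) :
    c ≤ moduleDepth A (KoszulHomology u (m - g)) ∧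
    (c < ((d - g : ℕ) : ℕ∞) → c + 1 ≤ moduleDepth A (KoszulHomology u (m - g))) := by
  have := hA.noetherian
  subst hu
  have hdA : (d : ℕ∞) = moduleDepth A A := by
    have h := hA.depth_eq_dim.trans hd
    exact_mod_cast h.symm
  have hH0 := nontrivial_koszulHomology_zero u hI
  have hbound (n : ℕ) (hn : (n : ℕ∞) ≤ moduleDepth A (KoszulHomology u 0)) : n + g ≤ d := by
    have h := add_le_ringKrullDim_of_le_moduleDepth hI (span_le_annihilator_koszulHomology u 0)
      hn hg.le
    rw [hd] at h
    exact_mod_cast h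
  have hcH (i : ℕ) (hi : i < m - g) : c ≤ moduleDepth A (KoszulHomology u i) :=
    hc.trans_le (iInf_le (fun i : Fin (m - g) => moduleDepth A (KoszulHomology u i)) ⟨i, hi⟩)
  have hc0 := hcH 0 (by omega)
  have hctop : c ≠ ⊤ := by
    rintro rfl
    have := hbound (d + 1) (le_top.trans hc0)
    omega
  lift c to ℕ using hctop
  have hcd := hbound c hc0
  -- The bound min(d - g, c + 2): the first term is depth B_{m-g} less one, the second comes from
  -- Z_{m-g}.
  have key (e : ℕ) (he : e ≤ c + 2) (hed : e + g ≤ d) :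
      (e : ℕ∞) ≤ moduleDepth A (KoszulHomology u (m - g)) := by
    refine natCast_le_moduleDepth_koszulHomology u ?_
      (natCast_le_moduleDepth_koszulCycles u (le_trans ?_ hdA.le) fun i hi => le_trans ?_ (hcH i hi))
    · refine le_trans ?_ (natCast_le_moduleDepth_koszulBoundaries_of_le_grade u hg.le hdA.le
        (j := g) le_rfl (by omega) (by omega))
      exact_mod_cast (by omega)
    · exact_mod_cast (by omega)
    · exact_mod_cast (by omega)
  refine ⟨key c (by omega) hcd, fun hlt => ?_⟩
  have hlt : c < d - g := by exact_mod_cast hlt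
  exact_mod_cast key (c + 1) (by omega) (by omega)
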